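/- For $\nu\in\mathbb{R}$ and $x>0$ let $K_\nu(x)=\int_0^\infty e^{-x\cosh s}\cosh(\nu s)\,ds$ be the modified Bessel function of the second kind, and for $\nu>-\tfrac12$, $-1<\beta<1$ put $I_{\nu,\beta}=\int_0^\infty e^{\beta t}t^\nu K_\nu(t)\,dt$. Let $0<\beta<1$. All the integrals below converge absolutely. (i) For all $x>0$ and $\nu\le\tfrac12$, $$\int_x^\infty e^{\beta t}t^\nu K_\nu(t)\,dt\le\frac{1}{1-\beta}\,e^{\beta x}x^\nu K_\nu(x);$$ the inequality is reversed if $\nu>\tfrac12$. For every $\nu\in\mathbb{R}$ and $x>0$, equality holds if and only if $\nu=\tfrac12$. (ii) Let $\nu>\tfrac12$. Then for all $x>0$, $$\frac{1}{1-\beta}\,e^{\beta x}x^\nu K_\nu(x)<\int_x^\infty e^{\beta t}t^\nu K_\nu(t)\,dt<\frac{I_{\nu,\beta}}{2^{\nu-1}\Gamma(\nu)}\,e^{\beta x}x^\nu K_\nu(x).$$ The constants are best possible: for the given $\nu$ and $\beta$, $\frac1{1-\beta}$ is the largest real $c$ such that $c\,e^{\beta x}x^\nu K_\nu(x)\le\int_x^\infty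 e^{\beta t}t^\nu K_\nu(t)\,dt$ for all $x>0$, and $\frac{I_{\nu,\beta}}{2^{\nu-1}\Gamma(\nu)}$ is the smallest real $c$ such that $\int_x^\infty e^{\beta t}t^\nu K_\nu(t)\,dt\le c\,e^{\beta x}x^\nu K_\nu(x)$ for all $x>0$. (iii) Let $\nu\ge-\tfrac12$. Then for all $x>0$, $$\frac{1}{1-\beta}\,e^{\beta x}x^{\nu+1}K_{\nu+1}(x)\le\int_x^\infty e^{\beta t}t^{\nu+1}K_\nu(t)\,dt\le\Big(1+\frac{\beta I_{\nu+1,\beta}}{2^\nu\Gamma(\nu+1)}\Big)e^{\beta x}x^{\nu+1}K_{\nu+1}(x).$$ For each $x>0$, equality holds in the lower bound if and only if $\nu=-\tfrac12$, and equality holds in the upper bound if and only if $\nu=-\tfrac12$. The constants are best possible: for the given $\nu$ and $\beta$, $\frac1{1-\beta}$ is the largest real $c$ such that $c\,e^{\beta x}x^{\nu+1}K_{\nu+1}(x)\le\int_x^\infty e^{\beta t}t^{\nu+1}K_\nu(t)\,dt$ for all $x>0$, and $1+\frac{\beta I_{\nu+1,\beta}}{2^\nu\Gamma(\nu+1)}$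 is the smallest real $c$ such that $\int_x^\infty e^{\beta t}t^{\nu+1}K_\nu(t)\,dt\le c\,e^{\beta x}x^{\nu+1}K_{\nu+1}(x)$ for all $x>0$. -/

import Mathlib

open Real Set MeasureTheory

noncomputable section

/-- The modified Bessel function of the second kind of real order `ν`, for an argument `x > 0`:
`K_ν(x) = ∫_0^∞ exp (-x cosh s) cosh (ν s) ds` (the integral converges absolutely for every real
`ν` and every `x > 0`). -/
def besselK (ν x : ℝ) : ℝ :=
  ∫ s in Ioi (0 : ℝ), Real.exp (-x * Real.cosh s) * Real.cosh (ν * s)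

/-- `I_{ν,β} = ∫_0^∞ exp (β t) t^ν K_ν(t) dt`, for `ν > -1/2` and `-1 < β < 1`. -/
def besselKTotal (ν β : ℝ) : ℝ :=
  ∫ t in Ioi (0 : ℝ), Real.exp (β * t) * t ^ ν * besselK ν t

end

open Filter Topology

/-! Write `h(x) = x^ν K_ν(x)`, `G(x) = e^{βx} h(x)` and `J(x) = ∫_x^∞ G`. Since `h' = -x^ν K_{ν-1}`,
integration by parts gives `∫_x^∞ e^{βt} t^ν K_{ν-1} = G + βJ`
(`integral_exp_mul_rpow_mul_besselK_sub_one`). As `K` increases with the absolute value of its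
order, comparing `|ν-1|` with `|ν|` compares `(1-β)J` with `G`; the two agree exactly at `ν = 1/2`.

For the upper bound with `ν > 1/2`, `h'/h = -K_{ν-1}/K_ν` strictly decreases
(`besselK_mul_besselK_lt`). Hence `h(x+u)/h(x)` lies strictly below its limit `h(u)/h(0+)` at `x →
0+`, where `h(0+) = 2^{ν-1} Γ(ν)`; integrating against `e^{β(x+u)}` in `u` gives the constant. It is
sharp as `x → 0+`; the lower constant is sharp as `x → ∞`, where `K_{ν-1}/K_ν → 1`.

In (iii) the same identity at order `ν+1` writes the integral as `G + βJ`, so each constant `c` at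
order `ν+1` becomes `1 + βc`. -/

/-- The excluded point `b` is null; it serves the ratio argument below, where both integrands vanish
at one point. -/
theorem setIntegral_Ioi_lt_of_forall_ne {f g : ℝ → ℝ} {a : ℝ} (b : ℝ)
    (hf : IntegrableOn f (Ioi a)) (hg : IntegrableOn g (Ioi a))
    (h : ∀ t, a < t → t ≠ b → f t < g t) : ∫ t in Ioi a, f t < ∫ t in Ioi a, g t := by
  have hae : ∀ᵐ t ∂(volume.restrict (Ioi a)), f t < g t := by
    have hb : ∀ᵐ t ∂(volume.restrict (Ioi a)), t ≠ b :=
      ae_restrict_of_ae (by simp [ae_iff])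
    filter_upwards [ae_restrict_mem measurableSet_Ioi, hb] with t ht htb using h t ht htb
  have hfg : Integrable (fun t => g t - f t) (volume.restrict (Ioi a)) := hg.sub hf
  rw [← sub_pos, ← integral_sub hg hf, integral_pos_iff_support_of_nonneg_ae
    (by filter_upwards [hae] with t ht using sub_nonneg.2 ht.le) hfg]
  rw [pos_iff_ne_zero]
  intro h0
  have h1 : ∀ᵐ t ∂(volume.restrict (Ioi a)), False := by
    have h2 : ∀ᵐ t ∂(volume.restrict (Ioi a)), t ∉ Function.support fun t => g t - f t :=
      measure_eq_zero_iff_ae_notMem.1 h0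
    filter_upwards [hae, h2] with t ht ht2
    exact ht2 (by simpa using (sub_pos.2 ht).ne')
  rw [Filter.eventually_false_iff_eq_bot, ae_eq_bot, Measure.restrict_eq_zero, volume_Ioi] at h1
  exact ENNReal.top_ne_zero h1

theorem setIntegral_Ioi_lt {f g : ℝ → ℝ} {a : ℝ}
    (hf : IntegrableOn f (Ioi a)) (hg : IntegrableOn g (Ioi a))
    (h : ∀ t, a < t → f t < g t) : ∫ t in Ioi a, f t < ∫ t in Ioi a, g t :=
  setIntegral_Ioi_lt_of_forall_ne a hf hg fun t ht _ => h t ht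

/-! ### Integral representation, derivative and recurrence of `K_ν` -/

theorem Real.cosh_le_exp_abs_self (s : ℝ) : cosh s ≤ exp |s| := by
  rw [← cosh_abs, cosh_eq]
  have : exp (-|s|) ≤ exp |s| := exp_le_exp.2 (by linarith [abs_nonneg s])
  linarith

theorem Real.sq_div_four_le_cosh {s : ℝ} (hs : 0 ≤ s) : s ^ 2 / 4 ≤ cosh s := by
  rw [cosh_eq]
  have := quadratic_le_exp_of_nonneg hs
  have := exp_pos (-s)
  linarith

/-- Completing the square in `s`, after `cosh s ≥ s²/4`. The factor `e^{-s}` supplies both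
integrability and vanishing boundary terms. -/
theorem exp_neg_mul_cosh_mul_cosh_le {x : ℝ} (hx : 0 < x) (ν : ℝ) {s : ℝ} (hs : 0 ≤ s) :
    exp (-x * cosh s) * cosh (ν * s) ≤ exp ((|ν| + 1) ^ 2 / x) * exp (-1 * s) := by
  have h1 : cosh (ν * s) ≤ exp (|ν| * s) := by
    simpa [abs_mul, abs_of_nonneg hs] using cosh_le_exp_abs_self (ν * s)
  have h2 : x * (s ^ 2 / 4) ≤ x * cosh s := mul_le_mul_of_nonneg_left (sq_div_four_le_cosh hs) hx.le
  have h3 : (|ν| + 1) * s ≤ (|ν| + 1) ^ 2 / x + x * (s ^ 2 / 4) := by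
    have : (|ν| + 1) ^ 2 / x + x * (s ^ 2 / 4) - (|ν| + 1) * s
        = ((|ν| + 1) - x * s / 2) ^ 2 / x := by
      field_simp
      ring
    have : 0 ≤ ((|ν| + 1) - x * s / 2) ^ 2 / x := by positivity
    linarith
  calc exp (-x * cosh s) * cosh (ν * s) ≤ exp (-x * cosh s) * exp (|ν| * s) := by gcongr
    _ = exp (-x * cosh s + |ν| * s) := (exp_add _ _).symm
    _ ≤ exp ((|ν| + 1) ^ 2 / x + -1 * s) := exp_le_exp.2 (by linarith)
    _ = _ := exp_add _ _

theorem integrableOn_exp_neg_mul_cosh_mul_cosh {x : ℝ} (hx : 0 < x) (ν : ℝ) :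
    IntegrableOn (fun s => exp (-x * cosh s) * cosh (ν * s)) (Ioi 0) := by
  refine Integrable.mono' ((exp_neg_integrableOn_Ioi 0 one_pos).const_mul
    (exp ((|ν| + 1) ^ 2 / x))) (by fun_prop) ?_
  filter_upwards [ae_restrict_mem measurableSet_Ioi] with s hs
  rw [norm_of_nonneg (by positivity)]
  exact exp_neg_mul_cosh_mul_cosh_le hx ν (le_of_lt hs)

theorem besselK_pos (ν : ℝ) {x : ℝ} (hx : 0 < x) : 0 < besselK ν x := by
  have := setIntegral_Ioi_lt (f := fun _ => 0) integrableOn_zero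
    (integrableOn_exp_neg_mul_cosh_mul_cosh hx ν) (fun t _ => by positivity)
  simpa [besselK] using this

theorem besselK_lt_besselK_of_abs_lt {μ ν x : ℝ} (hx : 0 < x) (h : |μ| < |ν|) :
    besselK μ x < besselK ν x := by
  refine setIntegral_Ioi_lt (integrableOn_exp_neg_mul_cosh_mul_cosh hx μ)
    (integrableOn_exp_neg_mul_cosh_mul_cosh hx ν) fun t ht => ?_
  have : cosh (μ * t) < cosh (ν * t) := by
    rw [cosh_lt_cosh, abs_mul, abs_mul]
    exact mul_lt_mul_of_pos_right h (abs_pos.2 ht.ne')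
  gcongr

theorem besselK_neg (ν x : ℝ) : besselK (-ν) x = besselK ν x := by
  simp [besselK]

/-- Follows from `cosh s ≥ 1`; this decay is what absorbs `e^{βt}` for `β < 1`. -/
theorem besselK_le_exp_mul {ν x t : ℝ} (hx : 0 < x) (hxt : x ≤ t) :
    besselK ν t ≤ exp (-(t - x)) * besselK ν x := by
  unfold besselK
  rw [← integral_const_mul]
  refine setIntegral_mono_on (integrableOn_exp_neg_mul_cosh_mul_cosh (hx.trans_le hxt) ν)
    ((integrableOn_exp_neg_mul_cosh_mul_cosh hx ν).const_mul _) measurableSet_Ioi fun s _ => ?_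
  rw [← mul_assoc, ← exp_add]
  gcongr
  nlinarith [one_le_cosh s]

theorem hasDerivAt_besselK (ν : ℝ) {x : ℝ} (hx : 0 < x) :
    HasDerivAt (besselK ν) (-((besselK (ν + 1) x + besselK (ν - 1) x) / 2)) x := by
  have hcosh (s : ℝ) : cosh s * cosh (ν * s)
      = (cosh ((ν + 1) * s) + cosh ((ν - 1) * s)) / 2 := by
    rw [add_mul, sub_mul, one_mul, cosh_add, cosh_sub]
    ring
  have hint {y : ℝ} (hy : 0 < y) : IntegrableOn
      (fun s => -(exp (-y * cosh s) * (cosh s * cosh (ν * s)))) (Ioi 0) := by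
    refine ((((integrableOn_exp_neg_mul_cosh_mul_cosh hy (ν + 1)).add
      (integrableOn_exp_neg_mul_cosh_mul_cosh hy (ν - 1))).div_const 2).neg).congr
      (ae_of_all _ fun s => ?_)
    simp only [Pi.add_apply, Pi.neg_apply, hcosh]
    ring
  have key := (hasDerivAt_integral_of_dominated_loc_of_deriv_le
    (μ := volume.restrict (Ioi (0 : ℝ)))
    (F := fun y s => exp (-y * cosh s) * cosh (ν * s))
    (F' := fun y s => -(exp (-y * cosh s) * (cosh s * cosh (ν * s))))
    -- The derivative's size decreases in `y`, so its value at `x / 2` dominates it for all `y > x /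
    -- 2`.
    (bound := fun s => ‖-(exp (-(x / 2) * cosh s) * (cosh s * cosh (ν * s)))‖)
    (Ioi_mem_nhds (show x / 2 < x by linarith)) (Eventually.of_forall fun y => by fun_prop)
    (integrableOn_exp_neg_mul_cosh_mul_cosh hx ν) (by fun_prop)
    (ae_of_all _ fun s y hy => ?_) (hint (half_pos hx)).norm
    (ae_of_all _ fun s y hy => ?_)).2
  · refine key.congr_deriv ?_
    rw [besselK, besselK, ← integral_add (integrableOn_exp_neg_mul_cosh_mul_cosh hx _)
      (integrableOn_exp_neg_mul_cosh_mul_cosh hx _), ← integral_div, ← integral_neg]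
    refine integral_congr_ae (ae_of_all _ fun s => ?_)
    simp only [hcosh]
    ring
  · have hy' : x / 2 < y := hy
    simp only [norm_neg]
    rw [norm_of_nonneg (by positivity), norm_of_nonneg (by positivity)]
    gcongr
  · have := ((hasDerivAt_id y).neg.mul_const (cosh s)).exp.mul_const (cosh (ν * s))
    refine this.congr_deriv ?_
    simp
    ring

/-- Integrate the derivative of `exp (-x cosh s) sinh (ν s)` over `(0, ∞)`; both boundary values are
zero. -/
theorem besselK_recurrence (ν : ℝ) {x : ℝ} (hx : 0 < x) :
    x * (besselK (ν + 1) x - besselK (ν - 1) x) = 2 * ν * besselK ν x := by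
  have hsinh (s : ℝ) : cosh ((ν + 1) * s) - cosh ((ν - 1) * s) = 2 * (sinh s * sinh (ν * s)) := by
    rw [add_mul, sub_mul, one_mul, cosh_add, cosh_sub]
    ring
  have h1 := integrableOn_exp_neg_mul_cosh_mul_cosh hx (ν + 1)
  have h2 := integrableOn_exp_neg_mul_cosh_mul_cosh hx (ν - 1)
  have h3 := integrableOn_exp_neg_mul_cosh_mul_cosh hx ν
  have hlim : Tendsto (fun s => exp (-x * cosh s) * sinh (ν * s)) atTop (𝓝 0) := by
    have hb : Tendsto (fun s => exp ((|ν| + 1) ^ 2 / x) * exp (-1 * s)) atTop (𝓝 0) := by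
      have : Tendsto (fun s : ℝ => exp (-1 * s)) atTop (𝓝 0) := by
        simpa using tendsto_exp_neg_atTop_nhds_zero
      simpa using this.const_mul (exp ((|ν| + 1) ^ 2 / x))
    refine squeeze_zero_norm' ?_ hb
    filter_upwards [eventually_ge_atTop 0] with s hs
    refine le_trans ?_ (exp_neg_mul_cosh_mul_cosh_le hx ν hs)
    rw [norm_mul, norm_of_nonneg (exp_pos _).le]
    gcongr
    rw [norm_eq_abs, abs_sinh, ← cosh_abs (ν * s)]
    exact (sinh_lt_cosh _).le
  have h := integral_Ioi_of_hasDerivAt_of_tendsto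
    (f := fun s => exp (-x * cosh s) * sinh (ν * s)) (a := 0) (m := 0)
    (f' := fun s => ν * (exp (-x * cosh s) * cosh (ν * s))
      - x / 2 * (exp (-x * cosh s) * cosh ((ν + 1) * s)
        - exp (-x * cosh s) * cosh ((ν - 1) * s)))
    (Continuous.continuousWithinAt (by fun_prop)) (fun s _ => ?_)
    ((h3.const_mul ν).sub ((h1.sub h2).const_mul (x / 2))) hlim
  · have h12 : Integrable (fun s => exp (-x * cosh s) * cosh ((ν + 1) * s)
        - exp (-x * cosh s) * cosh ((ν - 1) * s)) (volume.restrict (Ioi 0)) := h1.sub h2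
    rw [integral_sub (h3.const_mul ν) (h12.const_mul (x / 2)), integral_const_mul,
      integral_const_mul, integral_sub h1 h2] at h
    simp only [mul_zero, sinh_zero, sub_zero] at h
    unfold besselK
    linarith
  · have := (((hasDerivAt_cosh s).const_mul (-x)).exp).mul
      (((hasDerivAt_id s).const_mul ν).sinh)
    refine this.congr_deriv ?_
    rw [← mul_sub, hsinh]
    simp
    ring

theorem hasDerivAt_rpow_mul_besselK (ν : ℝ) {x : ℝ} (hx : 0 < x) :
    HasDerivAt (fun t => t ^ ν * besselK ν t) (-(x ^ ν * besselK (ν - 1) x)) x := by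
  have h := (hasDerivAt_rpow_const (p := ν) (Or.inl hx.ne')).mul (hasDerivAt_besselK ν hx)
  refine h.congr_deriv ?_
  have hr := besselK_recurrence ν hx
  have hp : x ^ ν = x ^ (ν - 1) * x := by rw [rpow_sub_one hx.ne']; field_simp
  rw [hp]
  linear_combination -(x ^ (ν - 1) / 2) * hr

theorem continuousOn_besselK (ν : ℝ) : ContinuousOn (besselK ν) (Ioi 0) :=
  fun _ hx => (hasDerivAt_besselK ν hx).continuousAt.continuousWithinAt

/-! ### Monotonicity of `K_μ / K_ν` -/

/-- By product-to-sum formulas, since `b t ± a s` exceeds `|a t ± b s|`. Equivalently `cosh (a s) /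
cosh (b s)` decreases, so the sign change used below is unique. -/
theorem cosh_mul_cosh_lt {a b s t : ℝ} (hab : |a| < b) (hs : 0 ≤ s) (hst : s < t) :
    cosh (a * t) * cosh (b * s) < cosh (a * s) * cosh (b * t) := by
  obtain ⟨h1, h2⟩ := abs_lt.1 hab
  have e1 : cosh (a * t + b * s) < cosh (b * t + a * s) := by
    rw [cosh_lt_cosh]
    refine lt_of_lt_of_le ?_ (le_abs_self _)
    rw [abs_lt]
    constructor <;> nlinarith
  have e2 : cosh (a * t - b * s) < cosh (b * t - a * s) := by
    rw [cosh_lt_cosh]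
    refine lt_of_lt_of_le ?_ (le_abs_self _)
    rw [abs_lt]
    constructor <;> nlinarith
  rw [cosh_add, cosh_add] at e1
  rw [cosh_sub, cosh_sub] at e2
  linarith

/-- The quotient `K_μ / K_ν` is strictly increasing on `(0, ∞)` when `|μ| < ν`. -/
theorem besselK_mul_besselK_lt {μ ν x y : ℝ} (hμν : |μ| < ν) (hx : 0 < x) (hxy : x < y) :
    besselK μ x * besselK ν y < besselK μ y * besselK ν x := by
  have hy := hx.trans hxy
  have hKx := besselK_pos ν hx
  -- With this `c`, the integral of `exp (-x cosh s) (cosh (μ s) - c cosh (ν s))` is zero, so the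
  -- bracket, positive at `s = 0`, changes sign at some `s₀`.
  set c := besselK μ x / besselK ν x with hc
  have hcK : besselK μ x = c * besselK ν x := by rw [hc]; field_simp
  have hc1 : c < 1 := by
    rw [hc, div_lt_one hKx]
    exact besselK_lt_besselK_of_abs_lt hx (hμν.trans_le (le_abs_self ν))
  have Iμ {z : ℝ} (hz : 0 < z) := integrableOn_exp_neg_mul_cosh_mul_cosh hz μ
  have Iν {z : ℝ} (hz : 0 < z) := (integrableOn_exp_neg_mul_cosh_mul_cosh hz ν).const_mul c
  have hint {z : ℝ} (hz : 0 < z) : ∫ s in Ioi (0 : ℝ), (exp (-z * cosh s) * cosh (μ * s)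
      - c * (exp (-z * cosh s) * cosh (ν * s))) = besselK μ z - c * besselK ν z := by
    rw [integral_sub (Iμ hz) (Iν hz), integral_const_mul, besselK, besselK]
  have hI {z : ℝ} (hz : 0 < z) : IntegrableOn (fun s => exp (-z * cosh s) * cosh (μ * s)
      - c * (exp (-z * cosh s) * cosh (ν * s))) (Ioi 0) := (Iμ hz).sub (Iν hz)
  obtain ⟨s₁, hs₁, hs₁'⟩ : ∃ s₁, 0 < s₁ ∧ cosh (μ * s₁) - c * cosh (ν * s₁) ≤ 0 := by
    by_contra! hcon
    have h := setIntegral_Ioi_lt (f := fun _ => 0) integrableOn_zero (hI hx)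
      (fun s hs => by linarith [mul_pos (exp_pos (-x * cosh s)) (hcon s hs)])
    rw [hint hx, hcK] at h
    simp at h
  obtain ⟨s₀, hs₀, hs₀'⟩ : ∃ s₀ ∈ Icc 0 s₁, cosh (μ * s₀) - c * cosh (ν * s₀) = 0 := by
    have := intermediate_value_Icc' hs₁.le
      (f := fun s => cosh (μ * s) - c * cosh (ν * s)) (by fun_prop)
    exact this ⟨hs₁', by simpa using hc1.le⟩
  -- Passing from `x` to `y` multiplies the integrand by a decreasing weight with value `k` at `s₀`.
  -- The bracket is positive before `s₀` and negative after, so replacing the weight by `k` lowers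
  -- the integral, to `0`.
  set k := exp (-(y - x) * cosh s₀) with hk
  have h := setIntegral_Ioi_lt_of_forall_ne s₀ ((hI hx).const_mul k) (hI hy) (fun s hs hne => ?_)
  · rw [integral_const_mul, hint hx, hint hy, hcK, sub_self, mul_zero] at h
    calc _ = (c * besselK ν y) * besselK ν x := by rw [hcK]; ring
      _ < _ := by gcongr; linarith
  · have hexp : exp (-y * cosh s) = exp (-(y - x) * cosh s) * exp (-x * cosh s) := by
      rw [← exp_add]; congr 1; ring
    have hprod : 0 < (exp (-(y - x) * cosh s) - k) * (cosh (μ * s) - c * cosh (ν * s)) := by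
      have hcs₀ := cosh_pos (ν * s₀)
      rcases lt_or_gt_of_ne hne with hlt | hgt
      · have h1 := cosh_mul_cosh_lt hμν hs.le hlt
        rw [sub_eq_zero.1 hs₀'] at h1
        refine mul_pos (sub_pos.2 (exp_lt_exp.2 ?_)) (sub_pos.2 ?_)
        · have : cosh s < cosh s₀ := by
            rwa [cosh_lt_cosh, abs_of_pos hs, abs_of_pos (hs.trans hlt)]
          nlinarith
        · nlinarith
      · have h1 := cosh_mul_cosh_lt hμν hs₀.1 hgt
        rw [sub_eq_zero.1 hs₀'] at h1
        refine mul_pos_of_neg_of_neg (sub_neg.2 (exp_lt_exp.2 ?_)) (sub_neg.2 ?_)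
        · have : cosh s₀ < cosh s := by
            rwa [cosh_lt_cosh, abs_of_pos hs, abs_of_nonneg hs₀.1]
          nlinarith
        · nlinarith
    rw [hexp]
    nlinarith [mul_pos hprod (exp_pos (-x * cosh s))]

/-! ### Limit of `x^ν K_ν(x)` at zero -/

/-- The substitution `u = (x / 2) e^s` exposes a truncated Gamma integral. For `ν > 0` its last
factor stays between 1 and 2, which permits dominated convergence as `x → 0+`. -/
theorem rpow_mul_besselK_eq_integral (ν : ℝ) {x : ℝ} (hx : 0 < x) :
    x ^ ν * besselK ν x = 2 ^ (ν - 1) * ∫ u in Ioi (x / 2),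
      exp (-u - x ^ 2 / (4 * u)) * u ^ (ν - 1) * (1 + (x / 2 / u) ^ (2 * ν)) := by
  have himg : (fun s => x / 2 * exp s) '' Ioi 0 = Ioi (x / 2) := by
    ext u
    simp only [mem_image, mem_Ioi]
    constructor
    · rintro ⟨s, hs, rfl⟩
      exact lt_mul_of_one_lt_right (half_pos hx) (one_lt_exp_iff.2 hs)
    · intro hu
      have h1 : 1 < u / (x / 2) := (one_lt_div (half_pos hx)).2 hu
      refine ⟨log (u / (x / 2)), log_pos h1, ?_⟩
      rw [exp_log (by linarith)]
      field_simp
  have hinj : InjOn (fun s => x / 2 * exp s) (Ioi 0) := fun s _ t _ h =>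
    exp_injective (mul_left_cancel₀ (half_pos hx).ne' h)
  rw [← himg, integral_image_eq_integral_abs_deriv_smul measurableSet_Ioi
    (fun s _ => ((hasDerivAt_exp s).const_mul (x / 2)).hasDerivWithinAt) hinj, besselK,
    ← integral_const_mul, ← integral_const_mul]
  refine integral_congr_ae (ae_of_all _ fun s => ?_)
  have hu : 0 < x / 2 * exp s := by positivity
  have e1 : -(x / 2 * exp s) - x ^ 2 / (4 * (x / 2 * exp s)) = -x * cosh s := by
    rw [cosh_eq, exp_neg]
    field_simp
    ring
  have e2 : x / 2 / (x / 2 * exp s) = exp (-s) := by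
    rw [exp_neg]
    field_simp
  have e3 : (x / 2 * exp s) ^ (ν - 1) = x ^ ν / 2 ^ ν * exp (ν * s) / (x / 2 * exp s) := by
    rw [rpow_sub_one hu.ne', mul_rpow (half_pos hx).le (exp_pos s).le,
      div_rpow hx.le zero_le_two, ← exp_mul, mul_comm s]
  have e4 : exp (-s) ^ (2 * ν) = exp (-(ν * s)) / exp (ν * s) := by
    rw [← exp_mul, ← exp_sub]
    congr 1
    ring
  simp only [smul_eq_mul]
  rw [abs_of_pos hu, e1, e2, e3, e4, cosh_eq (ν * s), rpow_sub_one two_ne_zero]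
  field_simp

theorem tendsto_rpow_mul_besselK {ν : ℝ} (hν : 0 < ν) :
    Tendsto (fun x => x ^ ν * besselK ν x) (𝓝[>] 0) (𝓝 (2 ^ (ν - 1) * Gamma ν)) := by
  have h : Tendsto (fun x : ℝ => ∫ u in Ioi (0 : ℝ), (Ioi (x / 2)).indicator
      (fun u => exp (-u - x ^ 2 / (4 * u)) * u ^ (ν - 1) * (1 + (x / 2 / u) ^ (2 * ν))) u)
      (𝓝[>] 0) (𝓝 (Gamma ν)) := by
    rw [Gamma_eq_integral hν]
    refine tendsto_integral_filter_of_dominated_convergence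
      (fun u => exp (-u) * u ^ (ν - 1) * 2) (Eventually.of_forall fun x => ?_) ?_
      ((GammaIntegral_convergent hν).mul_const 2) ?_
    · exact (Measurable.indicator (by fun_prop) measurableSet_Ioi).aestronglyMeasurable
    · filter_upwards [self_mem_nhdsWithin] with x hx
      have hx : 0 < x := hx
      filter_upwards [ae_restrict_mem measurableSet_Ioi] with u hu
      have hu : 0 < u := hu
      by_cases hxu : x / 2 < u
      · rw [indicator_of_mem (by exact hxu), norm_of_nonneg (by positivity)]
        have h1 : (x / 2 / u) ^ (2 * ν) ≤ 1 :=
          rpow_le_one (by positivity) ((div_le_one hu).2 hxu.le) (by linarith)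
        have h2 : exp (-u - x ^ 2 / (4 * u)) ≤ exp (-u) :=
          exp_le_exp.2 (sub_le_self _ (by positivity))
        gcongr
        linarith
      · rw [indicator_of_notMem (by exact hxu), norm_zero]
        positivity
    · filter_upwards [ae_restrict_mem measurableSet_Ioi] with u hu
      have hu : 0 < u := hu
      have hlim : Tendsto (fun x : ℝ => exp (-u - x ^ 2 / (4 * u)) * u ^ (ν - 1) *
          (1 + (x / 2 / u) ^ (2 * ν))) (𝓝[>] 0) (𝓝 (exp (-u) * u ^ (ν - 1))) := by
        have hc : ContinuousAt (fun x : ℝ => exp (-u - x ^ 2 / (4 * u)) * u ^ (ν - 1) *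
          (1 + (x / 2 / u) ^ (2 * ν))) 0 := by
          refine ContinuousAt.mul (by fun_prop) (continuousAt_const.add
            (ContinuousAt.rpow_const (by fun_prop) (Or.inr (by linarith))))
        have := hc.tendsto
        rw [zero_div, zero_div, zero_rpow (by linarith)] at this
        simpa using this.mono_left nhdsWithin_le_nhds
      refine hlim.congr' ?_
      filter_upwards [Ioo_mem_nhdsGT hu] with x hx
      rw [indicator_of_mem]
      exact mem_Ioi.2 (by linarith [hx.1, hx.2])
  refine (h.const_mul (2 ^ (ν - 1))).congr' ?_
  filter_upwards [self_mem_nhdsWithin] with x hx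
  have hx : 0 < x := hx
  rw [rpow_mul_besselK_eq_integral ν hx, setIntegral_indicator measurableSet_Ioi,
    Ioi_inter_Ioi, sup_eq_right.2 (half_pos hx).le]

/-! ### The weighted integrand and integration by parts -/

theorem continuousOn_exp_mul_rpow_mul_besselK (β p ν : ℝ) :
    ContinuousOn (fun t => exp (β * t) * t ^ p * besselK ν t) (Ioi 0) :=
  (ContinuousOn.mul (by fun_prop)
    (continuousOn_id.rpow_const fun t ht => Or.inl (ne_of_gt ht))).mul (continuousOn_besselK ν)

theorem exp_mul_rpow_mul_besselK_pos (β p ν : ℝ) {t : ℝ} (ht : 0 < t) :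
    0 < exp (β * t) * t ^ p * besselK ν t := by
  have := besselK_pos ν ht
  positivity

theorem exp_mul_rpow_mul_besselK_isBigO {β : ℝ} (hβ : β < 1) (p ν : ℝ) :
    (fun t => exp (β * t) * t ^ p * besselK ν t) =O[atTop]
      fun t => exp (-((1 - β) / 2) * t) := by
  have h1 : (fun t => exp (β * t) * besselK ν t) =O[atTop] fun t => exp (-(1 - β) * t) := by
    refine Asymptotics.IsBigO.of_bound (exp 1 * besselK ν 1) ?_
    filter_upwards [eventually_ge_atTop 1] with t ht
    have hK := besselK_pos ν (one_pos.trans_le ht)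
    rw [norm_of_nonneg (by positivity), norm_of_nonneg (exp_pos _).le]
    calc exp (β * t) * besselK ν t ≤ exp (β * t) * (exp (-(t - 1)) * besselK ν 1) := by
          gcongr
          exact besselK_le_exp_mul one_pos ht
      _ = exp (β * t) * exp (-(t - 1)) * besselK ν 1 := by ring
      _ = exp 1 * exp (-(1 - β) * t) * besselK ν 1 := by
          rw [← exp_add, ← exp_add]
          ring_nf
      _ = _ := by ring
  -- Half of the decay rate `1 - β` is spent on absorbing `t ^ p`.
  have h2 := h1.mul
    (isLittleO_rpow_exp_pos_mul_atTop p (b := (1 - β) / 2) (by linarith)).isBigO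
  refine (h2.congr_left fun t => by ring).congr_right fun t => ?_
  rw [← exp_add]
  ring_nf

theorem integrableOn_exp_mul_rpow_mul_besselK {β : ℝ} (hβ : β < 1) (p ν : ℝ) {x : ℝ}
    (hx : 0 < x) : IntegrableOn (fun t => exp (β * t) * t ^ p * besselK ν t) (Ioi x) :=
  integrable_of_isBigO_exp_neg (b := (1 - β) / 2) (by linarith)
    ((continuousOn_exp_mul_rpow_mul_besselK β p ν).mono fun _ ht => hx.trans_le ht)
    (exp_mul_rpow_mul_besselK_isBigO hβ p ν)

theorem tendsto_exp_mul_rpow_mul_besselK_atTop {β : ℝ} (hβ : β < 1) (p ν : ℝ) :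
    Tendsto (fun t => exp (β * t) * t ^ p * besselK ν t) atTop (𝓝 0) := by
  refine (exp_mul_rpow_mul_besselK_isBigO hβ p ν).trans_tendsto ?_
  simp only [neg_mul]
  exact tendsto_exp_neg_atTop_nhds_zero.comp
    (tendsto_id.const_mul_atTop (show (0 : ℝ) < (1 - β) / 2 by linarith))

theorem integral_exp_mul_rpow_mul_besselK_sub_one {β : ℝ} (hβ : β < 1) (ν : ℝ) {x : ℝ}
    (hx : 0 < x) : ∫ t in Ioi x, exp (β * t) * t ^ ν * besselK (ν - 1) t
      = exp (β * x) * x ^ ν * besselK ν x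
        + β * ∫ t in Ioi x, exp (β * t) * t ^ ν * besselK ν t := by
  have i1 := integrableOn_exp_mul_rpow_mul_besselK hβ ν ν hx
  have i2 := integrableOn_exp_mul_rpow_mul_besselK hβ ν (ν - 1) hx
  have h := integral_Ioi_of_hasDerivAt_of_tendsto (a := x)
    (f := fun t => exp (β * t) * t ^ ν * besselK ν t)
    (f' := fun t => β * (exp (β * t) * t ^ ν * besselK ν t)
      - exp (β * t) * t ^ ν * besselK (ν - 1) t)
    ((continuousOn_exp_mul_rpow_mul_besselK β ν ν).continuousAt
      (Ioi_mem_nhds hx)).continuousWithinAt (fun t ht => ?_) ((i1.const_mul β).sub i2)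
    (tendsto_exp_mul_rpow_mul_besselK_atTop hβ ν ν)
  · rw [integral_sub (i1.const_mul β) i2, integral_const_mul] at h
    linarith
  · have h1 := ((hasDerivAt_id t).const_mul β).exp.mul
      (hasDerivAt_rpow_mul_besselK ν (hx.trans ht))
    refine (h1.congr_of_eventuallyEq (Eventually.of_forall fun s => ?_)).congr_deriv ?_
    · simp [mul_assoc]
    · simp
      ring

theorem integral_exp_mul_rpow_mul_besselK_lt {β : ℝ} (hβ : β < 1) (p : ℝ) {μ ν x : ℝ}
    (hx : 0 < x) (h : |μ| < |ν|) : ∫ t in Ioi x, exp (β * t) * t ^ p * besselK μ t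
      < ∫ t in Ioi x, exp (β * t) * t ^ p * besselK ν t := by
  refine setIntegral_Ioi_lt (integrableOn_exp_mul_rpow_mul_besselK hβ p μ hx)
    (integrableOn_exp_mul_rpow_mul_besselK hβ p ν hx) fun t ht => ?_
  have ht : 0 < t := hx.trans ht
  have := besselK_lt_besselK_of_abs_lt ht h
  gcongr

/-! ### Comparison with the constant `1 / (1 - β)` -/

theorem lt_integral_of_half_lt {β : ℝ} (hβ : β < 1) {ν x : ℝ} (hν : 1 / 2 < ν) (hx : 0 < x) :
    1 / (1 - β) * (exp (β * x) * x ^ ν * besselK ν x)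
      < ∫ t in Ioi x, exp (β * t) * t ^ ν * besselK ν t := by
  have h1 := integral_exp_mul_rpow_mul_besselK_sub_one hβ ν hx
  have h2 : |ν - 1| < |ν| := by
    rw [abs_of_pos (by linarith : 0 < ν), abs_lt]
    constructor <;> linarith
  have h3 := integral_exp_mul_rpow_mul_besselK_lt hβ ν hx h2
  rw [one_div_mul_eq_div, div_lt_iff₀ (sub_pos.2 hβ)]
  linarith

theorem integral_lt_of_lt_half {β : ℝ} (hβ : β < 1) {ν x : ℝ} (hν : ν < 1 / 2) (hx : 0 < x) :
    ∫ t in Ioi x, exp (β * t) * t ^ ν * besselK ν t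
      < 1 / (1 - β) * (exp (β * x) * x ^ ν * besselK ν x) := by
  have h1 := integral_exp_mul_rpow_mul_besselK_sub_one hβ ν hx
  have h2 : |ν| < |ν - 1| := by
    rw [abs_of_neg (by linarith : ν - 1 < 0), abs_lt]
    constructor <;> linarith
  have h3 := integral_exp_mul_rpow_mul_besselK_lt hβ ν hx h2
  rw [one_div_mul_eq_div, lt_div_iff₀ (sub_pos.2 hβ)]
  linarith

theorem integral_half_eq {β : ℝ} (hβ : β < 1) {x : ℝ} (hx : 0 < x) :
    ∫ t in Ioi x, exp (β * t) * t ^ (1 / 2 : ℝ) * besselK (1 / 2) t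
      = 1 / (1 - β) * (exp (β * x) * x ^ (1 / 2 : ℝ) * besselK (1 / 2) x) := by
  have h1 := integral_exp_mul_rpow_mul_besselK_sub_one hβ (1 / 2) hx
  have h2 (t : ℝ) : besselK (1 / 2 - 1) t = besselK (1 / 2) t := by
    rw [← besselK_neg]
    norm_num
  simp only [h2] at h1
  rw [one_div_mul_eq_div, eq_div_iff (sub_pos.2 hβ).ne']
  linarith

theorem integral_eq_iff_eq_half {β : ℝ} (hβ : β < 1) {ν x : ℝ} (hx : 0 < x) :
    ∫ t in Ioi x, exp (β * t) * t ^ ν * besselK ν t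
      = 1 / (1 - β) * (exp (β * x) * x ^ ν * besselK ν x) ↔ ν = 1 / 2 := by
  refine ⟨fun h => ?_, fun h => h ▸ integral_half_eq hβ hx⟩
  rcases lt_trichotomy ν (1 / 2) with hν | hν | hν
  · exact absurd h (integral_lt_of_lt_half hβ hν hx).ne
  · exact hν
  · exact absurd h (lt_integral_of_half_lt hβ hν hx).ne'

theorem le_integral_of_half_le {β : ℝ} (hβ : β < 1) {ν x : ℝ} (hν : 1 / 2 ≤ ν) (hx : 0 < x) :
    1 / (1 - β) * (exp (β * x) * x ^ ν * besselK ν x)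
      ≤ ∫ t in Ioi x, exp (β * t) * t ^ ν * besselK ν t := by
  rcases hν.eq_or_lt with h | h
  · exact ((integral_eq_iff_eq_half hβ hx).2 h.symm).ge
  · exact (lt_integral_of_half_lt hβ h hx).le

theorem integral_le_of_le_half {β : ℝ} (hβ : β < 1) {ν x : ℝ} (hν : ν ≤ 1 / 2) (hx : 0 < x) :
    ∫ t in Ioi x, exp (β * t) * t ^ ν * besselK ν t
      ≤ 1 / (1 - β) * (exp (β * x) * x ^ ν * besselK ν x) := by
  rcases hν.eq_or_lt with h | h
  · exact ((integral_eq_iff_eq_half hβ hx).2 h).le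
  · exact (integral_lt_of_lt_half hβ h hx).le

/-! ### Sharpness of the lower constant at infinity -/

theorem mul_besselK_le_besselK_sub_one {ν x t : ℝ} (hν : 0 ≤ ν) (hx : 0 < x)
    (hxt : x ≤ t) : (1 - 2 * ν / x) * besselK ν t ≤ besselK (ν - 1) t := by
  have ht := hx.trans_le hxt
  have hr := besselK_recurrence ν ht
  have hK := besselK_pos ν ht
  have h1 : besselK ν t ≤ besselK (ν + 1) t := by
    refine (besselK_lt_besselK_of_abs_lt ht ?_).le
    rw [abs_of_nonneg hν, abs_of_nonneg (by linarith)]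
    linarith
  have h2 : besselK (ν + 1) t - besselK (ν - 1) t = 2 * ν / t * besselK ν t := by
    rw [div_mul_eq_mul_div, eq_div_iff ht.ne', ← hr]
    ring
  have h3 : 2 * ν / t * besselK ν t ≤ 2 * ν / x * besselK ν t := by gcongr
  linarith

/-- Inserting the preceding bound into the integration by parts gives `(1 - 2ν/x - β) J ≤ G`. With
`c G ≤ J` this yields `c (1 - 2ν/x - β) ≤ 1` for large `x`; then `x → ∞`. -/
theorem le_one_div_of_forall_le_integral {β : ℝ} (hβ : β < 1) {ν c : ℝ} (hν : 0 ≤ ν)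
    (hc : ∀ x, 0 < x → c * (exp (β * x) * x ^ ν * besselK ν x)
      ≤ ∫ t in Ioi x, exp (β * t) * t ^ ν * besselK ν t) : c ≤ 1 / (1 - β) := by
  rw [le_div_iff₀ (sub_pos.2 hβ)]
  have hlim : Tendsto (fun x : ℝ => 1 - 2 * ν / x - β) atTop (𝓝 (1 - β)) := by
    simpa using ((tendsto_const_nhds (x := (1 : ℝ))).sub
      ((tendsto_const_nhds (x := 2 * ν)).div_atTop tendsto_id)).sub_const β
  refine le_of_tendsto (hlim.const_mul c) ?_
  filter_upwards [eventually_gt_atTop 0, hlim.eventually_const_le (sub_pos.2 hβ)] with x hx hx'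
  have i1 := integrableOn_exp_mul_rpow_mul_besselK hβ ν ν hx
  have i2 := integrableOn_exp_mul_rpow_mul_besselK hβ ν (ν - 1) hx
  have hf := exp_mul_rpow_mul_besselK_pos β ν ν hx
  have h1 := integral_exp_mul_rpow_mul_besselK_sub_one hβ ν hx
  have h2 : (1 - 2 * ν / x) * ∫ t in Ioi x, exp (β * t) * t ^ ν * besselK ν t
      ≤ ∫ t in Ioi x, exp (β * t) * t ^ ν * besselK (ν - 1) t := by
    rw [← integral_const_mul]
    refine setIntegral_mono_on (i1.const_mul _) i2 measurableSet_Ioi fun t ht => ?_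
    have ht0 : 0 < t := hx.trans ht
    calc _ = exp (β * t) * t ^ ν * ((1 - 2 * ν / x) * besselK ν t) := by ring
      _ ≤ _ := by
        gcongr
        exact mul_besselK_le_besselK_sub_one hν hx (le_of_lt ht)
  have h3 := mul_le_mul_of_nonneg_left (hc x hx) hx'
  refine le_of_mul_le_mul_right ?_ hf
  linarith

/-! ### Behaviour at zero and sharpness of the upper constant -/

theorem tendsto_exp_mul_rpow_mul_besselK_zero (β : ℝ) {ν : ℝ} (hν : 0 < ν) :
    Tendsto (fun t => exp (β * t) * t ^ ν * besselK ν t) (𝓝[>] 0)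
      (𝓝 (2 ^ (ν - 1) * Gamma ν)) := by
  have he : Tendsto (fun t => exp (β * t)) (𝓝[>] 0) (𝓝 1) := by
    have : Tendsto (fun t => exp (β * t)) (𝓝 0) (𝓝 (exp (β * 0))) :=
      Continuous.tendsto (by fun_prop) 0
    simpa using this.mono_left nhdsWithin_le_nhds
  simpa only [mul_assoc, one_mul] using he.mul (tendsto_rpow_mul_besselK hν)

theorem integrableOn_exp_mul_rpow_mul_besselK_zero {β : ℝ} (hβ : β < 1) {ν : ℝ} (hν : 0 < ν) :
    IntegrableOn (fun t => exp (β * t) * t ^ ν * besselK ν t) (Ioi 0) := by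
  obtain ⟨δ, hδ, hδ'⟩ := mem_nhdsGT_iff_exists_Ioc_subset.1
    ((tendsto_exp_mul_rpow_mul_besselK_zero β hν).eventually_le_const (lt_add_one _))
  have hδ : 0 < δ := hδ
  rw [← Ioc_union_Ioi_eq_Ioi hδ.le]
  refine IntegrableOn.union ?_ (integrableOn_exp_mul_rpow_mul_besselK hβ ν ν hδ)
  refine Integrable.mono'
    (integrable_const (2 ^ (ν - 1) * Gamma ν + 1))
    (((continuousOn_exp_mul_rpow_mul_besselK β ν ν).mono Ioc_subset_Ioi_self).aestronglyMeasurable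
      measurableSet_Ioc) ?_
  filter_upwards [ae_restrict_mem measurableSet_Ioc] with t ht
  rw [norm_of_nonneg (exp_mul_rpow_mul_besselK_pos β ν ν ht.1).le]
  exact hδ' ht

theorem tendsto_integral_besselKTotal {β : ℝ} (hβ : β < 1) {ν : ℝ} (hν : 0 < ν) :
    Tendsto (fun x => ∫ t in Ioi x, exp (β * t) * t ^ ν * besselK ν t) (𝓝[>] 0)
      (𝓝 (besselKTotal ν β)) := by
  have hint := integrableOn_exp_mul_rpow_mul_besselK_zero hβ hν
  have h : Tendsto (fun x : ℝ => ∫ t in Ioi (0 : ℝ), (Ioi x).indicator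
      (fun t => exp (β * t) * t ^ ν * besselK ν t) t) (𝓝[>] 0) (𝓝 (besselKTotal ν β)) := by
    refine tendsto_integral_filter_of_dominated_convergence _
      (Eventually.of_forall fun x => hint.aestronglyMeasurable.indicator measurableSet_Ioi)
      (Eventually.of_forall fun x => ae_of_all _ fun t => norm_indicator_le_norm_self _ _)
      hint.norm ?_
    filter_upwards [ae_restrict_mem measurableSet_Ioi] with t ht
    refine tendsto_const_nhds.congr' ?_
    filter_upwards [Ioo_mem_nhdsGT (show (0 : ℝ) < t from ht)] with x hx
    rw [indicator_of_mem (mem_Ioi.2 hx.2)]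
  refine h.congr' ?_
  filter_upwards [self_mem_nhdsWithin] with x hx
  rw [setIntegral_indicator measurableSet_Ioi, Ioi_inter_Ioi, sup_eq_right.2 (le_of_lt hx)]

theorem besselKTotal_div_le {β : ℝ} (hβ : β < 1) {ν c : ℝ} (hν : 0 < ν)
    (hc : ∀ x, 0 < x → ∫ t in Ioi x, exp (β * t) * t ^ ν * besselK ν t
      ≤ c * (exp (β * x) * x ^ ν * besselK ν x)) :
    besselKTotal ν β / (2 ^ (ν - 1) * Gamma ν) ≤ c := by
  have hG := Gamma_pos_of_pos hν
  rw [div_le_iff₀ (by positivity)]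
  refine le_of_tendsto_of_tendsto (tendsto_integral_besselKTotal hβ hν)
    ((tendsto_exp_mul_rpow_mul_besselK_zero β hν).const_mul c) ?_
  filter_upwards [self_mem_nhdsWithin] with x hx using hc x hx

/-! ### Log-concavity and the upper bound -/

/-- Strict log-concavity of `x ↦ x ^ ν * K_ν(x)` for `ν > 1 / 2`. -/
theorem strictAntiOn_rpow_mul_besselK_add_div {ν u : ℝ} (hν : 1 / 2 < ν) (hu : 0 < u) :
    StrictAntiOn (fun x => ((x + u) ^ ν * besselK ν (x + u)) / (x ^ ν * besselK ν x))
      (Ioi 0) := by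
  have hpos {x : ℝ} (hx : 0 < x) : 0 < x ^ ν * besselK ν x := by
    have := besselK_pos ν hx
    positivity
  have hd {x : ℝ} (hx : 0 < x) :=
    ((hasDerivAt_rpow_mul_besselK ν (add_pos hx hu)).comp_add_const x u).div
      (hasDerivAt_rpow_mul_besselK ν hx) (hpos hx).ne'
  refine strictAntiOn_of_deriv_neg (convex_Ioi 0)
    (fun x hx => (hd hx).continuousAt.continuousWithinAt) fun x hx => ?_
  rw [interior_Ioi] at hx
  have hx : 0 < x := hx
  refine ((hd hx).deriv.trans_lt ?_)
  refine div_neg_of_neg_of_pos ?_ (pow_pos (hpos hx) 2)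
  -- The sign of the quotient's derivative is that of `K_{ν-1}(x) K_ν(x+u) - K_{ν-1}(x+u) K_ν(x)`;
  -- `|ν - 1| < ν` is where `ν > 1/2` enters.
  have h1 := besselK_mul_besselK_lt (μ := ν - 1) (ν := ν)
    (by rw [abs_lt]; constructor <;> linarith) hx (show x < x + u by linarith)
  have h2 : 0 < x ^ ν * (x + u) ^ ν := by positivity
  nlinarith [mul_lt_mul_of_pos_left h1 h2]

theorem rpow_mul_besselK_add_lt {ν u x : ℝ} (hν : 1 / 2 < ν) (hu : 0 < u) (hx : 0 < x) :
    (x + u) ^ ν * besselK ν (x + u)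
      < u ^ ν * besselK ν u / (2 ^ (ν - 1) * Gamma ν) * (x ^ ν * besselK ν x) := by
  have hG := Gamma_pos_of_pos (show 0 < ν by linarith)
  have hK := besselK_pos ν hx
  have hanti := strictAntiOn_rpow_mul_besselK_add_div hν hu
  have hlim : Tendsto (fun x => ((x + u) ^ ν * besselK ν (x + u)) / (x ^ ν * besselK ν x))
      (𝓝[>] 0) (𝓝 (u ^ ν * besselK ν u / (2 ^ (ν - 1) * Gamma ν))) := by
    refine Tendsto.div ?_ (tendsto_rpow_mul_besselK (by linarith)) (by positivity)
    have hc : ContinuousAt (fun x => (x + u) ^ ν * besselK ν (x + u)) 0 :=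
      ((hasDerivAt_rpow_mul_besselK ν (x := 0 + u) (by linarith)).comp_add_const 0 u).continuousAt
    simpa using hc.tendsto.mono_left nhdsWithin_le_nhds
  -- The limit gives only `≤`, so it is applied at `x / 2`; strictness comes from the step from `x /
  -- 2` to `x`.
  have hle := ge_of_tendsto hlim (b := ((x / 2 + u) ^ ν * besselK ν (x / 2 + u)) /
      ((x / 2) ^ ν * besselK ν (x / 2))) (by
    filter_upwards [Ioo_mem_nhdsGT (half_pos hx)] with y hy
    exact (hanti hy.1 (half_pos hx) hy.2).le)
  rw [← div_lt_iff₀ (by positivity)]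
  exact (hanti (half_pos hx) hx (half_lt_self hx)).trans_le hle

theorem setIntegral_Ioi_eq_comp_add (f : ℝ → ℝ) (x : ℝ) :
    ∫ t in Ioi x, f t = ∫ u in Ioi 0, f (x + u) := by
  rw [← (measurePreserving_add_left volume x).setIntegral_preimage_emb
    (measurableEmbedding_addLeft x)]
  simp

theorem integral_lt_besselKTotal_div_mul {β : ℝ} (hβ : β < 1) {ν x : ℝ} (hν : 1 / 2 < ν)
    (hx : 0 < x) : ∫ t in Ioi x, exp (β * t) * t ^ ν * besselK ν t
      < besselKTotal ν β / (2 ^ (ν - 1) * Gamma ν) * (exp (β * x) * x ^ ν * besselK ν x) := by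
  have h0 := integrableOn_exp_mul_rpow_mul_besselK_zero hβ (show 0 < ν by linarith)
  have h1 : IntegrableOn (fun u => exp (β * (x + u)) * (x + u) ^ ν * besselK ν (x + u))
      (Ioi 0) := by
    have := ((measurePreserving_add_left volume x).integrableOn_comp_preimage
      (measurableEmbedding_addLeft x)).2 (integrableOn_exp_mul_rpow_mul_besselK hβ ν ν hx)
    simpa [Function.comp_def] using this
  rw [setIntegral_Ioi_eq_comp_add]
  calc _ < ∫ u in Ioi 0, exp (β * x) * x ^ ν * besselK ν x / (2 ^ (ν - 1) * Gamma ν)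
          * (exp (β * u) * u ^ ν * besselK ν u) := by
        refine setIntegral_Ioi_lt h1 (h0.const_mul _) fun u hu => ?_
        have := mul_lt_mul_of_pos_left (rpow_mul_besselK_add_lt hν hu hx)
          (mul_pos (exp_pos (β * x)) (exp_pos (β * u)))
        rw [mul_add, exp_add, mul_assoc]
        exact this.trans_eq (by ring)
    _ = _ := by
        rw [integral_const_mul, besselKTotal]
        ring

/-- Let `x → 0+` in the exact identity `integral_half_eq`: the two constants coincide at order
`1/2`. -/
theorem besselKTotal_half {β : ℝ} (hβ : β < 1) :
    besselKTotal (1 / 2) β / (2 ^ (1 / 2 - 1 : ℝ) * Gamma (1 / 2)) = 1 / (1 - β) := by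
  have hG : 0 < (2 : ℝ) ^ (1 / 2 - 1 : ℝ) * Gamma (1 / 2) := by
    have := Gamma_pos_of_pos (show (0 : ℝ) < 1 / 2 by norm_num)
    positivity
  rw [div_eq_iff hG.ne']
  refine tendsto_nhds_unique (tendsto_integral_besselKTotal hβ (by norm_num))
    (((tendsto_exp_mul_rpow_mul_besselK_zero β (by norm_num)).const_mul (1 / (1 - β))).congr' ?_)
  filter_upwards [self_mem_nhdsWithin] with x hx using (integral_half_eq hβ hx).symm

theorem integral_le_besselKTotal_div_mul {β : ℝ} (hβ : β < 1) {ν x : ℝ} (hν : 1 / 2 ≤ ν)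
    (hx : 0 < x) : ∫ t in Ioi x, exp (β * t) * t ^ ν * besselK ν t
      ≤ besselKTotal ν β / (2 ^ (ν - 1) * Gamma ν) * (exp (β * x) * x ^ ν * besselK ν x) := by
  rcases hν.eq_or_lt with rfl | h
  · rw [besselKTotal_half hβ]
    exact (integral_half_eq hβ hx).le
  · exact (integral_lt_besselKTotal_div_mul hβ h hx).le

theorem integral_eq_besselKTotal_div_mul_iff {β : ℝ} (hβ : β < 1) {ν x : ℝ} (hν : 1 / 2 ≤ ν)
    (hx : 0 < x) : ∫ t in Ioi x, exp (β * t) * t ^ ν * besselK ν t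
      = besselKTotal ν β / (2 ^ (ν - 1) * Gamma ν) * (exp (β * x) * x ^ ν * besselK ν x) ↔
      ν = 1 / 2 := by
  refine ⟨fun h => ?_, ?_⟩
  · by_contra hne
    exact (integral_lt_besselKTotal_div_mul hβ (lt_of_le_of_ne hν (Ne.symm hne)) hx).ne h
  · rintro rfl
    rw [besselKTotal_half hβ]
    exact integral_half_eq hβ hx

/-! ### Assembly of the three statements -/

theorem mainTheorem1 (β : ℝ) (hβ0 : 0 < β) (hβ1 : β < 1) :
    -- (i)
    (∀ ν x : ℝ, 0 < x →
      IntegrableOn (fun t : ℝ => Real.exp (β * t) * t ^ ν * besselK ν t) (Ioi x) volume ∧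
      (ν ≤ 1 / 2 →
        ∫ t in Ioi x, Real.exp (β * t) * t ^ ν * besselK ν t
          ≤ 1 / (1 - β) * (Real.exp (β * x) * x ^ ν * besselK ν x)) ∧
      (1 / 2 < ν →
        1 / (1 - β) * (Real.exp (β * x) * x ^ ν * besselK ν x)
          ≤ ∫ t in Ioi x, Real.exp (β * t) * t ^ ν * besselK ν t) ∧
      (∫ t in Ioi x, Real.exp (β * t) * t ^ ν * besselK ν t
          = 1 / (1 - β) * (Real.exp (β * x) * x ^ ν * besselK ν x) ↔ ν = 1 / 2)) ∧
    -- (ii)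
    (∀ ν : ℝ, 1 / 2 < ν →
      IntegrableOn (fun t : ℝ => Real.exp (β * t) * t ^ ν * besselK ν t) (Ioi 0) volume ∧
      (∀ x : ℝ, 0 < x →
        1 / (1 - β) * (Real.exp (β * x) * x ^ ν * besselK ν x)
          < ∫ t in Ioi x, Real.exp (β * t) * t ^ ν * besselK ν t ∧
        ∫ t in Ioi x, Real.exp (β * t) * t ^ ν * besselK ν t
          < besselKTotal ν β / ((2 : ℝ) ^ (ν - 1) * Real.Gamma ν) *
              (Real.exp (β * x) * x ^ ν * besselK ν x)) ∧
      IsGreatest {c : ℝ | ∀ x : ℝ, 0 < x →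
        c * (Real.exp (β * x) * x ^ ν * besselK ν x)
          ≤ ∫ t in Ioi x, Real.exp (β * t) * t ^ ν * besselK ν t} (1 / (1 - β)) ∧
      IsLeast {c : ℝ | ∀ x : ℝ, 0 < x →
        ∫ t in Ioi x, Real.exp (β * t) * t ^ ν * besselK ν t
          ≤ c * (Real.exp (β * x) * x ^ ν * besselK ν x)}
        (besselKTotal ν β / ((2 : ℝ) ^ (ν - 1) * Real.Gamma ν))) ∧
    -- (iii)
    (∀ ν : ℝ, -(1 / 2) ≤ ν →
      IntegrableOn (fun t : ℝ => Real.exp (β * t) * t ^ (ν + 1) * besselK (ν + 1) t)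
        (Ioi 0) volume ∧
      (∀ x : ℝ, 0 < x →
        IntegrableOn (fun t : ℝ => Real.exp (β * t) * t ^ (ν + 1) * besselK ν t)
          (Ioi x) volume ∧
        1 / (1 - β) * (Real.exp (β * x) * x ^ (ν + 1) * besselK (ν + 1) x)
          ≤ ∫ t in Ioi x, Real.exp (β * t) * t ^ (ν + 1) * besselK ν t ∧
        (1 / (1 - β) * (Real.exp (β * x) * x ^ (ν + 1) * besselK (ν + 1) x)
          = ∫ t in Ioi x, Real.exp (β * t) * t ^ (ν + 1) * besselK ν t ↔ ν = -(1 / 2)) ∧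
        ∫ t in Ioi x, Real.exp (β * t) * t ^ (ν + 1) * besselK ν t
          ≤ (1 + β * besselKTotal (ν + 1) β / ((2 : ℝ) ^ ν * Real.Gamma (ν + 1))) *
              (Real.exp (β * x) * x ^ (ν + 1) * besselK (ν + 1) x) ∧
        (∫ t in Ioi x, Real.exp (β * t) * t ^ (ν + 1) * besselK ν t
          = (1 + β * besselKTotal (ν + 1) β / ((2 : ℝ) ^ ν * Real.Gamma (ν + 1))) *
              (Real.exp (β * x) * x ^ (ν + 1) * besselK (ν + 1) x) ↔ ν = -(1 / 2))) ∧
      IsGreatest {c : ℝ | ∀ x : ℝ, 0 < x →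
        c * (Real.exp (β * x) * x ^ (ν + 1) * besselK (ν + 1) x)
          ≤ ∫ t in Ioi x, Real.exp (β * t) * t ^ (ν + 1) * besselK ν t} (1 / (1 - β)) ∧
      IsLeast {c : ℝ | ∀ x : ℝ, 0 < x →
        ∫ t in Ioi x, Real.exp (β * t) * t ^ (ν + 1) * besselK ν t
          ≤ c * (Real.exp (β * x) * x ^ (ν + 1) * besselK (ν + 1) x)}
        (1 + β * besselKTotal (ν + 1) β / ((2 : ℝ) ^ ν * Real.Gamma (ν + 1)))) := by
  refine ⟨fun ν x hx => ⟨integrableOn_exp_mul_rpow_mul_besselK hβ1 ν ν hx,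
    fun hν => integral_le_of_le_half hβ1 hν hx, fun hν => (lt_integral_of_half_lt hβ1 hν hx).le,
    integral_eq_iff_eq_half hβ1 hx⟩, fun ν hν => ⟨?_, fun x hx => ⟨?_, ?_⟩, ⟨?_, ?_⟩, ?_, ?_⟩,
    fun ν hν => ?_⟩
  · exact integrableOn_exp_mul_rpow_mul_besselK_zero hβ1 (by linarith)
  · exact lt_integral_of_half_lt hβ1 hν hx
  · exact integral_lt_besselKTotal_div_mul hβ1 hν hx
  · exact fun x hx => (lt_integral_of_half_lt hβ1 hν hx).le
  · exact fun c hc => le_one_div_of_forall_le_integral hβ1 (by linarith) hc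
  · exact fun x hx => (integral_lt_besselKTotal_div_mul hβ1 hν hx).le
  · exact fun c hc => besselKTotal_div_le hβ1 (by linarith) hc
  · have hν' : 1 / 2 ≤ ν + 1 := by linarith
    have hiff : ν = -(1 / 2) ↔ ν + 1 = 1 / 2 := by constructor <;> intro h <;> linarith
    have hid (x : ℝ) (hx : 0 < x) := integral_exp_mul_rpow_mul_besselK_sub_one hβ1 (ν + 1) hx
    have hupper (x : ℝ) (hx : 0 < x) := integral_le_besselKTotal_div_mul hβ1 hν' hx
    have hupper_iff (x : ℝ) (hx : 0 < x) := integral_eq_besselKTotal_div_mul_iff hβ1 hν' hx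
    have hleast (c : ℝ) := besselKTotal_div_le (c := c) hβ1 (show 0 < ν + 1 by linarith)
    simp only [add_sub_cancel_right] at hid hupper hupper_iff hleast
    have hlower (x : ℝ) (hx : 0 < x) := le_integral_of_half_le hβ1 hν' hx
    have hlower_iff (x : ℝ) (hx : 0 < x) := integral_eq_iff_eq_half (ν := ν + 1) hβ1 hx
    set C := besselKTotal (ν + 1) β / ((2 : ℝ) ^ ν * Real.Gamma (ν + 1)) with hC
    -- `1 / (1 - β)` is the fixed point of `c ↦ 1 + β c`, so the lower constant is unchanged in
    -- (iii).
    have hβ : 1 / (1 - β) = 1 + β * (1 / (1 - β)) := by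
      have := (sub_pos.2 hβ1).ne'
      field_simp
      ring
    rw [mul_div_assoc, ← hC, hiff]
    have hlow (x : ℝ) (hx : 0 < x) := mul_le_mul_of_nonneg_left (hlower x hx) hβ0.le
    have hup (x : ℝ) (hx : 0 < x) := mul_le_mul_of_nonneg_left (hupper x hx) hβ0.le
    have hlow' (x : ℝ) (hx : 0 < x) :
        1 / (1 - β) * (Real.exp (β * x) * x ^ (ν + 1) * besselK (ν + 1) x)
          ≤ ∫ t in Ioi x, Real.exp (β * t) * t ^ (ν + 1) * besselK ν t := by
      rw [hid x hx, hβ]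
      linarith [hlow x hx]
    have hup' (x : ℝ) (hx : 0 < x) :
        ∫ t in Ioi x, Real.exp (β * t) * t ^ (ν + 1) * besselK ν t
          ≤ (1 + β * C) * (Real.exp (β * x) * x ^ (ν + 1) * besselK (ν + 1) x) := by
      rw [hid x hx]
      linarith [hup x hx]
    refine ⟨integrableOn_exp_mul_rpow_mul_besselK_zero hβ1 (by linarith), fun x hx =>
      ⟨integrableOn_exp_mul_rpow_mul_besselK hβ1 _ _ hx, hlow' x hx, ?_, hup' x hx, ?_⟩,
      ⟨hlow', fun c hc => ?_⟩, hup', fun c hc => ?_⟩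
    · rw [← hlower_iff x hx, hid x hx]
      constructor <;> intro h
      · refine mul_left_cancel₀ hβ0.ne' ?_
        rw [hβ] at h
        linarith
      · rw [h, hβ]
        linear_combination (β * (Real.exp (β * x) * x ^ (ν + 1) * besselK (ν + 1) x)) * hβ
    · rw [← hupper_iff x hx, hid x hx, add_mul, one_mul, add_right_inj, mul_assoc,
        mul_right_inj' hβ0.ne']
    -- Admissibility of `c` here is admissibility of `(c - 1) / β` at order `ν + 1`; dividing by `β`
    -- uses `0 < β`.
    · have h := le_one_div_of_forall_le_integral (ν := ν + 1) (c := (c - 1) / β) hβ1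
        (by linarith) fun x hx => by
          have := hc x hx
          rw [hid x hx] at this
          rw [div_mul_eq_mul_div, div_le_iff₀ hβ0]
          linarith
      rw [div_le_iff₀ hβ0] at h
      rw [hβ]
      linarith
    · have h := hleast ((c - 1) / β) fun x hx => by
          have := hc x hx
          rw [hid x hx] at this
          rw [div_mul_eq_mul_div, le_div_iff₀ hβ0]
          linarith
      rw [le_div_iff₀ hβ0] at h
      linarith
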